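/- Let $R$ be a commutative ring and $X,Y\in R$. The (Model I) associated Laguerre polynomials $L_n(x)=L_n(x;X,Y)\in R[x]$ are the monic polynomials defined by $L_{-1}(x)=0$, $L_0(x)=1$ and $$L_{n+1}(x)=(x-b_n)L_n(x)-\lambda_nL_{n-1}(x)\quad(n\ge 0),\qquad b_n=2n+X+Y,\quad \lambda_n=(n+X)(n-1+Y).$$ There is exactly one $R$-linear functional $\mathcal L:R[x]\to R$ with $\mathcal L(1)=1$ and $\mathcal L(L_mL_n)=0$ for all $m\neq n$; its values $\mu_n=\mathcal L(x^n)$ are the moments of these polynomials. For a permutation $\pi=\pi_1\cdots\pi_n\in\mathfrak S_n$, the entry $\pi_i$ is a right-to-left minimum if $\pi_i<\pi_j$ for all $j>i$, a left-to-right maximum if $\pi_i>\pi_j$ for all $j<i$, and a pivot if it is both. Let $\mathrm{RLmin}(\pi)$, $\mathrm{LRmax}(\pi)$ and $\mathrm{pivot}(\pi)$ be the numbers of right-to-left minima, left-to-right maxima and pivots of $\pi$. Then for every integer $n\ge 0$ $$\mu_n=\sum_{\pi\in\mathfrak S_n}(X+1)^{\mathrm{RLmin}(\pi)-\mathrm{pivot}(\pi)}\,(X+Y)^{\mathrm{pivot}(\pi)}\,Y^{\mathrm{LRmax}(\pi)-\mathrm{pivot}(\pi)}.$$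 In particular, if $R=\mathbb R$ and $\mu$ is any positive Borel measure on $\mathbb R$ of total mass $1$ with respect to which all polynomials are integrable and $\int L_mL_n\,d\mu=0$ for all $m\ne n$, then $\int x^n\,d\mu$ is equal to this sum for every $n\ge0$. -/

import Mathlib

open MeasureTheory

namespace AssocLaguerre

/-- The monic polynomials given by the three term recurrence
`p (n+1) = (x - b n) * p n - lam n * p (n-1)` with `p 0 = 1` and `p (-1) = 0`. -/
noncomputable def recPoly {R : Type*} [CommRing R] (b lam : ℕ → R) : ℕ → Polynomial R
  | 0 => 1
  | 1 => Polynomial.X - Polynomial.C (b 0)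
  | n + 2 => (Polynomial.X - Polynomial.C (b (n + 1))) * recPoly b lam (n + 1)
      - Polynomial.C (lam (n + 1)) * recPoly b lam n

/-- The (Model I) associated Laguerre polynomials `L_n(x; X, Y)`:
`b n = 2 n + X + Y` and `lam n = (n + X) (n - 1 + Y)`. -/
noncomputable def assocLaguerre {R : Type*} [CommRing R] (X Y : R) : ℕ → Polynomial R :=
  recPoly (fun n => 2 * (n : R) + X + Y) (fun n => ((n : R) + X) * ((n : R) - 1 + Y))

/-- `L` is a normalized linear functional on polynomials for which the sequence `p` is orthogonal.
The moments of `p` are the values `L (x ^ n)`. -/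
structure IsMomentFunctional {R : Type*} [CommRing R] (p : ℕ → Polynomial R)
    (L : Polynomial R →ₗ[R] R) : Prop where
  map_one : L 1 = 1
  orthogonal : ∀ m n : ℕ, m ≠ n → L (p m * p n) = 0

/-- `μ` is a measure for the real polynomials `p`: it has mass one, all polynomials are
integrable with respect to it, and the sequence `p` is orthogonal. -/
structure IsOrthogonalityMeasure (p : ℕ → Polynomial ℝ) (μ : Measure ℝ) : Prop where
  mass_one : μ Set.univ = 1
  integrable : ∀ q : Polynomial ℝ, Integrable (fun x => q.eval x) μ
  orthogonal : ∀ m n : ℕ, m ≠ n → ∫ x, (p m).eval x * (p n).eval x ∂μ = 0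

/-- The set of (values of) right-to-left minima of the word `π 0, π 1, …, π (n-1)`. -/
def RLMIN {n : ℕ} (π : Equiv.Perm (Fin n)) : Finset (Fin n) :=
  (Finset.univ.filter fun i => ∀ j, i < j → π i < π j).image π

/-- The set of (values of) left-to-right maxima of the word `π 0, π 1, …, π (n-1)`. -/
def LRMAX {n : ℕ} (π : Equiv.Perm (Fin n)) : Finset (Fin n) :=
  (Finset.univ.filter fun i => ∀ j, j < i → π j < π i).image π

/-- The number of right-to-left minima. -/
def RLmin {n : ℕ} (π : Equiv.Perm (Fin n)) : ℕ := (RLMIN π).card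

/-- The number of left-to-right maxima. -/
def LRmax {n : ℕ} (π : Equiv.Perm (Fin n)) : ℕ := (LRMAX π).card

/-- The number of pivots, i.e. of entries that are both a left-to-right maximum and a
right-to-left minimum. -/
def pivot {n : ℕ} (π : Equiv.Perm (Fin n)) : ℕ := (LRMAX π ∩ RLMIN π).card

/-- The subtractions `RLmin π - pivot π` are not truncated. -/
theorem pivot_le_RLmin {n : ℕ} (π : Equiv.Perm (Fin n)) : pivot π ≤ RLmin π :=
  Finset.card_le_card Finset.inter_subset_right

/-- The subtractions `LRmax π - pivot π` are not truncated. -/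
theorem pivot_le_LRmax {n : ℕ} (π : Equiv.Perm (Fin n)) : pivot π ≤ LRmax π :=
  Finset.card_le_card Finset.inter_subset_left

end AssocLaguerre

/-! Both sides obey the recursion of weighted Motzkin paths. For the functional, orthogonality and
the three-term recurrence force the values M(d, h) of L at x^d p_h to satisfy M(d+1, h) = M(d, h+1)
+ b_h M(d, h) + λ_h M(d, h-1), with M(0, h) = δ_{h,0}. This gives existence, uniqueness and the
moments (`IsMomentFunctional.apply_X_pow_mul`).

For permutations, scan the diagonal. Before stage i, some h positions and h values below i are still
unmatched ("open"). Value i enters an open position or stays open; then position i takes an open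
value or stays open. Of h open positions only the leftmost makes i a left-to-right maximum: total
weight Y + h - 1. Of k + 1 open values only the smallest is a right-to-left minimum: total weight X
+ 1 + k. If i is the only open value and no earlier position is open, i is a pivot: weight X + Y.
Hence b_h = (X + 1 + h) + (Y + h - 1) and λ_h = (Y + h - 1)(X + h) for h > 0, while b_0 = X + Y;
this is `totalWeight_eq_moment`.

Such local weights suffice because left-to-right maxima lie on or above the diagonal, right-to-left
minima on or below it, and on the diagonal the two notions coincide (`entryWeight_permGraph`). -/

namespace AssocLaguerre

/-! ### Moment functionals and the three-term recurrence -/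

section Functional

variable {R : Type*} [CommRing R]

/-- The values `L (x ^ d * p h)` of the moment functional `L` of `p = recPoly b lam`. -/
def moment (b lam : ℕ → R) : ℕ → ℕ → R
  | 0, 0 => 1
  | 0, _ + 1 => 0
  | d + 1, 0 => moment b lam d 1 + b 0 * moment b lam d 0
  | d + 1, h + 1 => moment b lam d (h + 2) + b (h + 1) * moment b lam d (h + 1)
      + lam (h + 1) * moment b lam d h

/-- One step lowers the height by at most one, so height 0 is out of reach. -/
theorem moment_eq_zero (b lam : ℕ → R) : ∀ d h : ℕ, d < h → moment b lam d h = 0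
  | _, 0, hd => absurd hd (Nat.not_lt_zero _)
  | 0, _ + 1, _ => by simp [moment]
  | d + 1, h + 1, hd => by
    rw [moment, moment_eq_zero b lam d (h + 2) (by lia), moment_eq_zero b lam d (h + 1) (by lia),
      moment_eq_zero b lam d h (by lia)]
    ring

theorem natDegree_recPoly_le (b lam : ℕ → R) : ∀ n : ℕ, (recPoly b lam n).natDegree ≤ n
  | 0 => by simp [recPoly]
  | 1 => by
    rw [recPoly]
    exact Polynomial.natDegree_X_sub_C_le _
  | n + 2 => by
    have h1 := natDegree_recPoly_le b lam (n + 1)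
    have h0 := natDegree_recPoly_le b lam n
    rw [recPoly]
    refine (Polynomial.natDegree_sub_le _ _).trans (max_le ?_ ?_)
    · refine Polynomial.natDegree_mul_le.trans ?_
      have := Polynomial.natDegree_X_sub_C_le (b (n + 1))
      lia
    · exact (Polynomial.natDegree_C_mul_le _ _).trans (by lia)

/-- A functional with the values `moment b lam d 0` on monomials has the values `moment b lam d h`
on `x ^ d * p h`. -/
theorem apply_X_pow_mul_recPoly {b lam : ℕ → R} {L : Polynomial R →ₗ[R] R}
    (hL : ∀ d, L (Polynomial.X ^ d) = moment b lam d 0) :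
    ∀ h d : ℕ, L (Polynomial.X ^ d * recPoly b lam h) = moment b lam d h
  | 0, d => by simp [recPoly, hL]
  | 1, d => by
    have e : (Polynomial.X : Polynomial R) ^ d * recPoly b lam 1
        = Polynomial.X ^ (d + 1) - b 0 • Polynomial.X ^ d := by
      rw [recPoly, Polynomial.smul_eq_C_mul]
      ring
    rw [e, map_sub, map_smul, hL, hL, moment, smul_eq_mul]
    ring
  | h + 2, d => by
    have e : (Polynomial.X : Polynomial R) ^ d * recPoly b lam (h + 2)
        = Polynomial.X ^ (d + 1) * recPoly b lam (h + 1)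
          - b (h + 1) • (Polynomial.X ^ d * recPoly b lam (h + 1))
          - lam (h + 1) • (Polynomial.X ^ d * recPoly b lam h) := by
      rw [recPoly, Polynomial.smul_eq_C_mul, Polynomial.smul_eq_C_mul]
      ring
    rw [e, map_sub, map_sub, map_smul, map_smul, apply_X_pow_mul_recPoly hL (h + 1),
      apply_X_pow_mul_recPoly hL (h + 1), apply_X_pow_mul_recPoly hL h, moment, smul_eq_mul,
      smul_eq_mul]
    ring

/-- Expanding `q` in monomials reduces this to `moment_eq_zero`; no basis property of the `recPoly`
is needed. -/
theorem apply_mul_recPoly_eq_zero {b lam : ℕ → R} {L : Polynomial R →ₗ[R] R}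
    (hL : ∀ d, L (Polynomial.X ^ d) = moment b lam d 0) {q : Polynomial R} {n : ℕ}
    (hq : q.natDegree < n) : L (q * recPoly b lam n) = 0 := by
  rw [q.as_sum_range_C_mul_X_pow, Finset.sum_mul, map_sum]
  refine Finset.sum_eq_zero fun d hd => ?_
  rw [mul_assoc, ← Polynomial.smul_eq_C_mul, map_smul, apply_X_pow_mul_recPoly hL,
    moment_eq_zero _ _ _ _ (by rw [Finset.mem_range] at hd; lia), smul_zero]

theorem isMomentFunctional_of_apply_X_pow {b lam : ℕ → R} {L : Polynomial R →ₗ[R] R}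
    (hL : ∀ d, L (Polynomial.X ^ d) = moment b lam d 0) :
    IsMomentFunctional (recPoly b lam) L where
  map_one := by simpa [moment] using hL 0
  orthogonal m n hmn := by
    rcases lt_or_gt_of_ne hmn with h | h
    · exact apply_mul_recPoly_eq_zero hL ((natDegree_recPoly_le b lam m).trans_lt h)
    · rw [mul_comm]
      exact apply_mul_recPoly_eq_zero hL ((natDegree_recPoly_le b lam n).trans_lt h)

theorem IsMomentFunctional.apply_X_pow_mul {b lam : ℕ → R} {L : Polynomial R →ₗ[R] R}
    (hL : IsMomentFunctional (recPoly b lam) L) :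
    ∀ d h : ℕ, L (Polynomial.X ^ d * recPoly b lam h) = moment b lam d h
  | 0, 0 => by simpa [recPoly, moment] using hL.map_one
  -- Only orthogonality to p_0 = 1 is used; the recurrence supplies the rest.
  | 0, h + 1 => by simpa [recPoly, moment] using hL.orthogonal 0 (h + 1) (by simp)
  | d + 1, 0 => by
    have e : (Polynomial.X : Polynomial R) ^ (d + 1) * recPoly b lam 0
        = Polynomial.X ^ d * recPoly b lam 1 + b 0 • (Polynomial.X ^ d * recPoly b lam 0) := by
      rw [recPoly, recPoly, Polynomial.smul_eq_C_mul]
      ring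
    rw [e, map_add, map_smul, hL.apply_X_pow_mul d, hL.apply_X_pow_mul d, moment, smul_eq_mul]
  | d + 1, h + 1 => by
    have e : (Polynomial.X : Polynomial R) ^ (d + 1) * recPoly b lam (h + 1)
        = Polynomial.X ^ d * recPoly b lam (h + 2)
          + b (h + 1) • (Polynomial.X ^ d * recPoly b lam (h + 1))
          + lam (h + 1) • (Polynomial.X ^ d * recPoly b lam h) := by
      rw [recPoly, Polynomial.smul_eq_C_mul, Polynomial.smul_eq_C_mul]
      ring
    rw [e, map_add, map_add, map_smul, map_smul, hL.apply_X_pow_mul d, hL.apply_X_pow_mul d,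
      hL.apply_X_pow_mul d, moment, smul_eq_mul, smul_eq_mul]

theorem IsMomentFunctional.apply_X_pow {b lam : ℕ → R} {L : Polynomial R →ₗ[R] R}
    (hL : IsMomentFunctional (recPoly b lam) L) (d : ℕ) :
    L (Polynomial.X ^ d) = moment b lam d 0 := by
  simpa [recPoly] using hL.apply_X_pow_mul d 0

theorem existsUnique_isMomentFunctional (b lam : ℕ → R) :
    ∃! L : Polynomial R →ₗ[R] R, IsMomentFunctional (recPoly b lam) L := by
  have hb : ∀ d, Polynomial.basisMonomials R d = Polynomial.X ^ d := fun d => by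
    rw [Polynomial.coe_basisMonomials]
    exact Polynomial.monomial_one_right_eq_X_pow d
  have h0 : ∀ d, (Polynomial.basisMonomials R).constr R (fun d => moment b lam d 0)
      (Polynomial.X ^ d) = moment b lam d 0 := fun d => by
    rw [← hb, Module.Basis.constr_basis]
  refine ⟨_, isMomentFunctional_of_apply_X_pow h0, fun L hL => ?_⟩
  refine (Polynomial.basisMonomials R).ext fun d => ?_
  rw [hb, hL.apply_X_pow, h0]

end Functional

/-! ### Partial permutation matrices -/

section Placements

open Classical in
/-- The graphs of the bijections from `P` to `V`. -/
noncomputable def placements (P V : Finset ℕ) : Finset (Finset (ℕ × ℕ)) :=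
  (P ×ˢ V).powerset.filter fun G =>
    (∀ p ∈ P, ∃! v, (p, v) ∈ G) ∧ ∀ v ∈ V, ∃! p, (p, v) ∈ G

theorem mem_placements {P V : Finset ℕ} {G : Finset (ℕ × ℕ)} :
    G ∈ placements P V ↔ (∀ p v, (p, v) ∈ G → p ∈ P ∧ v ∈ V) ∧
      (∀ p ∈ P, ∃! v, (p, v) ∈ G) ∧ ∀ v ∈ V, ∃! p, (p, v) ∈ G := by
  simp only [placements, Finset.mem_filter, Finset.mem_powerset, Finset.subset_iff, Prod.forall,
    Finset.mem_product]

theorem notMem_of_mem_placements_erase {P V : Finset ℕ} {G : Finset (ℕ × ℕ)} {q u : ℕ}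
    (hG : G ∈ placements (P.erase q) (V.erase u)) :
    ∀ e ∈ G, e.1 ≠ q ∧ e.2 ≠ u := by
  rintro ⟨p, v⟩ he
  have := (mem_placements.1 hG).1 p v he
  simp only [Finset.mem_erase] at this
  exact ⟨this.1.1, this.2.1⟩

theorem insert_mem_placements {P V : Finset ℕ} {G : Finset (ℕ × ℕ)} {q u : ℕ}
    (hq : q ∈ P) (hu : u ∈ V) (hG : G ∈ placements (P.erase q) (V.erase u)) :
    insert (q, u) G ∈ placements P V := by
  have hne := notMem_of_mem_placements_erase hG
  rw [mem_placements] at hG ⊢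
  obtain ⟨h1, h2, h3⟩ := hG
  refine ⟨fun p v h => ?_, fun p hp => ?_, fun v hv => ?_⟩
  · grind
  · by_cases hpq : p = q
    · subst hpq
      exact ⟨u, by simp, fun v hv => by grind⟩
    · obtain ⟨v, hv, hv'⟩ := h2 p (by grind)
      exact ⟨v, by grind, fun w hw => hv' w (by grind)⟩
  · by_cases hpq : v = u
    · subst hpq
      exact ⟨q, by simp, fun v hv => by grind⟩
    · obtain ⟨p, hv, hv'⟩ := h3 v (by grind)
      exact ⟨p, by grind, fun w hw => hv' w (by grind)⟩

theorem erase_mem_placements {P V : Finset ℕ} {G : Finset (ℕ × ℕ)} {q u : ℕ}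
    (hG : G ∈ placements P V) (hqu : (q, u) ∈ G) :
    G.erase (q, u) ∈ placements (P.erase q) (V.erase u) := by
  rw [mem_placements] at hG ⊢
  obtain ⟨h1, h2, h3⟩ := hG
  obtain ⟨hq, hu⟩ := h1 q u hqu
  refine ⟨fun p v h => ?_, fun p hp => ?_, fun v hv => ?_⟩
  · have hpv := Finset.mem_of_mem_erase h
    have h2' := fun w => (h2 q hq).unique (y₂ := w) hqu
    have h3' := fun w => (h3 u hu).unique (y₂ := w) hqu
    grind
  · obtain ⟨v, hv, hv'⟩ := h2 p (by grind)
    exact ⟨v, by grind, fun w hw => hv' w (by grind)⟩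
  · obtain ⟨p, hv, hv'⟩ := h3 v (by grind)
    exact ⟨p, by grind, fun w hw => hv' w (by grind)⟩

/-- `G'` avoids position `q'` and value `u'`; as one coordinate agrees, (q, u) cannot lie in `G'`,
so the inserted pairs coincide. -/
theorem insert_injective_of_notMem {q u q' u' : ℕ} {P V : Finset ℕ} {G G' : Finset (ℕ × ℕ)}
    (hG : G ∈ placements (P.erase q) (V.erase u)) (hG' : G' ∈ placements (P.erase q') (V.erase u'))
    (hqu : q = q' ∨ u = u') (h : insert (q, u) G = insert (q', u') G') :
    q = q' ∧ u = u' ∧ G = G' := by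
  have h1 := notMem_of_mem_placements_erase hG
  have h2 := notMem_of_mem_placements_erase hG'
  have h3 : (q, u) ∈ insert (q', u') G' := by rw [← h]; simp
  have h4 : (q, u) = (q', u') := by
    rcases Finset.mem_insert.1 h3 with h3 | h3
    · exact h3
    · have := h2 _ h3
      grind
  obtain ⟨rfl, rfl⟩ := Prod.mk.inj h4
  refine ⟨rfl, rfl, ?_⟩
  rw [← Finset.erase_insert (a := (q, u)) (s := G) fun hm => (h1 _ hm).1 rfl, h,
    Finset.erase_insert fun hm => (h2 _ hm).1 rfl]

variable {M : Type*} [AddCommMonoid M]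

/-- Splitting the bijections by the preimage of `u`. -/
theorem sum_placements_of_mem_right {P V : Finset ℕ} {u : ℕ} (hu : u ∈ V)
    (F : Finset (ℕ × ℕ) → M) :
    ∑ G ∈ placements P V, F G
      = ∑ q ∈ P, ∑ G ∈ placements (P.erase q) (V.erase u), F (insert (q, u) G) := by
  rw [Finset.sum_sigma']
  symm
  refine Finset.sum_bij (fun x _ => insert (x.1, u) x.2) ?_ ?_ ?_ ?_
  · rintro ⟨q, G⟩ hx
    rw [Finset.mem_sigma] at hx
    exact insert_mem_placements hx.1 hu hx.2
  · rintro ⟨q, G⟩ hx ⟨q', G'⟩ hx' h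
    rw [Finset.mem_sigma] at hx hx'
    obtain ⟨rfl, -, rfl⟩ := insert_injective_of_notMem hx.2 hx'.2 (Or.inr rfl) h
    rfl
  · intro G hG
    obtain ⟨h1, -, h3⟩ := mem_placements.1 hG
    obtain ⟨q, hq, -⟩ := h3 u hu
    exact ⟨⟨q, G.erase (q, u)⟩,
      Finset.mem_sigma.2 ⟨(h1 q u hq).1, erase_mem_placements hG hq⟩, Finset.insert_erase hq⟩
  · intro _ _
    rfl

/-- Splitting the bijections by the image of `q`. -/
theorem sum_placements_of_mem_left {P V : Finset ℕ} {q : ℕ} (hq : q ∈ P)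
    (F : Finset (ℕ × ℕ) → M) :
    ∑ G ∈ placements P V, F G
      = ∑ u ∈ V, ∑ G ∈ placements (P.erase q) (V.erase u), F (insert (q, u) G) := by
  rw [Finset.sum_sigma']
  symm
  refine Finset.sum_bij (fun x _ => insert (q, x.1) x.2) ?_ ?_ ?_ ?_
  · rintro ⟨u, G⟩ hx
    rw [Finset.mem_sigma] at hx
    exact insert_mem_placements hq hx.1 hx.2
  · rintro ⟨q, G⟩ hx ⟨q', G'⟩ hx' h
    rw [Finset.mem_sigma] at hx hx'
    obtain ⟨-, rfl, rfl⟩ := insert_injective_of_notMem hx.2 hx'.2 (Or.inl rfl) h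
    rfl
  · intro G hG
    obtain ⟨h1, h2, -⟩ := mem_placements.1 hG
    obtain ⟨u, hu, -⟩ := h2 q hq
    exact ⟨⟨u, G.erase (q, u)⟩,
      Finset.mem_sigma.2 ⟨(h1 q u hu).2, erase_mem_placements hG hu⟩, Finset.insert_erase hu⟩
  · intro _ _
    rfl

end Placements

/-! ### Local weights and one step of the diagonal scan -/

section Weights

variable {R : Type*} [CommRing R]

/-- The weight of the entry `e` of `G`: on or above the diagonal left-to-right maxima are marked,
on or below the diagonal right-to-left minima are marked. -/
def entryWeight (X Y : R) (G : Finset (ℕ × ℕ)) (e : ℕ × ℕ) : R :=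
  if e.1 < e.2 then if ∀ f ∈ G, f.1 < e.1 → f.2 < e.2 then Y else 1
  else if e.2 < e.1 then if ∀ f ∈ G, e.1 < f.1 → e.2 < f.2 then X + 1 else 1
  else if (∀ f ∈ G, f.1 < e.1 → f.2 < e.2) ∧ ∀ f ∈ G, e.1 < f.1 → e.2 < f.2 then X + Y else 1

/-- The product of the weights of the entries of `G`, and zero if some position less than `i` has
a value less than `j`. -/
def weight (X Y : R) (i j : ℕ) (G : Finset (ℕ × ℕ)) : R :=
  ∏ e ∈ G, if e.1 < i ∧ e.2 < j then 0 else entryWeight X Y G e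

/-- The total weight of the bijections from `P` to `V`. -/
noncomputable def totalWeight (X Y : R) (i j : ℕ) (P V : Finset ℕ) : R :=
  ∑ G ∈ placements P V, weight X Y i j G

theorem weight_eq_zero {X Y : R} {i j : ℕ} {G : Finset (ℕ × ℕ)} {e : ℕ × ℕ} (he : e ∈ G)
    (h1 : e.1 < i) (h2 : e.2 < j) : weight X Y i j G = 0 :=
  Finset.prod_eq_zero he (if_pos ⟨h1, h2⟩)

/-- A pair that cannot violate the conditions tested at `e` may be dropped from the graph. This lets
matched pairs be forgotten during the scan. -/
theorem entryWeight_insert {X Y : R} {G : Finset (ℕ × ℕ)} {e f : ℕ × ℕ}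
    (h1 : e.1 ≤ e.2 → f.1 < e.1 → f.2 < e.2) (h2 : e.2 ≤ e.1 → e.1 < f.1 → e.2 < f.2) :
    entryWeight X Y (insert f G) e = entryWeight X Y G e := by
  simp only [entryWeight, Finset.forall_mem_insert]
  rcases lt_trichotomy e.1 e.2 with h | h | h
  · simp only [h, if_true, eq_true (h1 h.le), true_and]
  · simp only [h, lt_irrefl, if_false]
    rw [← h]
    have h1' := h1 h.le
    have h2' := h2 h.ge
    rw [← h] at h1' h2'
    simp only [eq_true h1', eq_true h2', true_and]
  · simp only [h, h.not_gt, if_true, if_false, eq_true (h2 h.le), true_and]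

/-- Putting the value `i` into an open position. -/
theorem weight_insert_value_of_lt {X Y : R} {i q : ℕ} {G : Finset (ℕ × ℕ)} (hq : q < i)
    (hG : ∀ e ∈ G, e.1 ≠ q ∧ e.2 ≠ i) :
    weight X Y i i (insert (q, i) G)
      = entryWeight X Y (insert (q, i) G) (q, i) * weight X Y i (i + 1) G := by
  rw [weight, Finset.prod_insert fun h => (hG _ h).1 rfl, if_neg (by simp)]
  congr 1
  refine Finset.prod_congr rfl fun e he => ?_
  have := hG e he
  by_cases h : e.1 < i ∧ e.2 < i
  · rw [if_pos h, if_pos (by lia)]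
  -- Outside the i × i box, an entry on or above the diagonal has value greater than i, and one on
  -- or below it has position at least i > q.
  · rw [if_neg h, if_neg (by lia), entryWeight_insert] <;> dsimp only <;> lia

/-- Putting the value `i` into a later position. -/
theorem weight_insert_value_of_le {X Y : R} {i q : ℕ} {G : Finset (ℕ × ℕ)} (hq : i ≤ q)
    (hG : ∀ e ∈ G, e.1 ≠ q ∧ e.2 ≠ i) :
    weight X Y i i (insert (q, i) G) = weight X Y i (i + 1) (insert (q, i) G) := by
  refine Finset.prod_congr rfl fun e he => ?_
  congr 1
  rcases Finset.mem_insert.1 he with rfl | he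
  · simp [hq]
  · have := hG e he
    simp only [eq_iff_iff]
    lia

/-- Putting an open value into the position `i`. -/
theorem weight_insert_position_of_le {X Y : R} {i u : ℕ} {G : Finset (ℕ × ℕ)} (hu : u ≤ i)
    (hG : ∀ e ∈ G, e.1 ≠ i ∧ e.2 ≠ u) :
    weight X Y i (i + 1) (insert (i, u) G)
      = entryWeight X Y (insert (i, u) G) (i, u) * weight X Y (i + 1) (i + 1) G := by
  rw [weight, Finset.prod_insert fun h => (hG _ h).1 rfl, if_neg (by simp)]
  congr 1
  refine Finset.prod_congr rfl fun e he => ?_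
  have := hG e he
  by_cases h : e.1 < i ∧ e.2 < i + 1
  · rw [if_pos h, if_pos (by lia)]
  · rw [if_neg h, if_neg (by lia), entryWeight_insert] <;> dsimp only <;> lia

/-- Putting a later value into the position `i`. -/
theorem weight_insert_position_of_lt {X Y : R} {i u : ℕ} {G : Finset (ℕ × ℕ)} (hu : i < u)
    (hG : ∀ e ∈ G, e.1 ≠ i ∧ e.2 ≠ u) :
    weight X Y i (i + 1) (insert (i, u) G) = weight X Y (i + 1) (i + 1) (insert (i, u) G) := by
  refine Finset.prod_congr rfl fun e he => ?_
  congr 1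
  rcases Finset.mem_insert.1 he with rfl | he
  · simp; lia
  · have := hG e he
    simp only [eq_iff_iff]
    lia

/-- The factor for putting the value `i` into the open position `q`. -/
theorem entryWeight_insert_value {X Y : R} {i q : ℕ} {P V : Finset ℕ} {G : Finset (ℕ × ℕ)}
    (hq : q < i) (hG : G ∈ placements (P.erase q) (V.erase i))
    (hw : ∀ e ∈ G, ¬(e.1 < i ∧ e.2 < i + 1)) :
    entryWeight X Y (insert (q, i) G) (q, i) = if ∀ p ∈ P, q ≤ p then Y else 1 := by
  simp only [entryWeight, hq, if_true, Finset.forall_mem_insert, lt_irrefl, false_imp_iff, true_and]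
  obtain ⟨h1, h2, -⟩ := mem_placements.1 hG
  refine if_congr ⟨fun h p hp => ?_, fun h f hf hfq => ?_⟩ rfl rfl
  -- An open position left of `q` would have to receive a value greater than i, by `hw`.
  · by_contra! hpq
    obtain ⟨v, hv, -⟩ := h2 p (Finset.mem_erase.2 ⟨hpq.ne, hp⟩)
    have := h _ hv hpq
    have := hw _ hv
    dsimp only at *
    lia
  · have := h f.1 (Finset.mem_of_mem_erase (h1 f.1 f.2 hf).1)
    lia

/-- The factor for putting the open value `u` into the position `i`. -/
theorem entryWeight_insert_position {X Y : R} {i u : ℕ} {P V : Finset ℕ} {G : Finset (ℕ × ℕ)}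
    (hu : u ≤ i) (hG : G ∈ placements (P.erase i) (V.erase u))
    (hw : ∀ e ∈ G, ¬(e.1 < i + 1 ∧ e.2 < i + 1)) :
    entryWeight X Y (insert (i, u) G) (i, u) =
      if u < i then if ∀ v ∈ V, u ≤ v then X + 1 else 1
      else if (∀ p ∈ P, i ≤ p) ∧ ∀ v ∈ V, u ≤ v then X + Y else 1 := by
  simp only [entryWeight, hu.not_gt, if_false, Finset.forall_mem_insert, lt_irrefl, false_imp_iff,
    true_and]
  obtain ⟨h1, h2, h3⟩ := mem_placements.1 hG
  have hV : (∀ f ∈ G, i < f.1 → u < f.2) ↔ ∀ v ∈ V, u ≤ v := by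
    refine ⟨fun h v hv => ?_, fun h f hf hfq => ?_⟩
    -- An open value below `u` must sit at a position greater than i, by `hw`.
    · by_contra! hpq
      obtain ⟨p, hp, -⟩ := h3 v (Finset.mem_erase.2 ⟨hpq.ne, hv⟩)
      have := h _ hp
      have := hw _ hp
      dsimp only at *
      lia
    · have h4 := (h1 f.1 f.2 hf).2
      rw [Finset.mem_erase] at h4
      exact lt_of_le_of_ne (h f.2 h4.2) h4.1.symm
  by_cases hui : u < i
  · simp only [hui, if_true, hV]
  simp only [hui, if_false, hV]
  obtain rfl : u = i := by lia
  refine if_congr (and_congr_left' ⟨fun h p hp => ?_, fun h f hf hfq => ?_⟩) rfl rfl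
  · by_contra! hpq
    obtain ⟨v, hv, -⟩ := h2 p (Finset.mem_erase.2 ⟨hpq.ne, hp⟩)
    have := h _ hv hpq
    have := hw _ hv
    dsimp only at *
    lia
  · have := h f.1 (Finset.mem_of_mem_erase (h1 f.1 f.2 hf).1)
    lia

/-- Enlarging the forbidden box kills exactly the bijections that put value i in an open position;
the sum restores them, with the pair (q, i) split off. -/
theorem totalWeight_value_step (X Y : R) {i : ℕ} {P V : Finset ℕ} (hi : i ∈ V) :
    totalWeight X Y i i P V = totalWeight X Y i (i + 1) P V
      + ∑ q ∈ P with q < i, (if ∀ p ∈ P, q ≤ p then Y else 1)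
          * totalWeight X Y i (i + 1) (P.erase q) (V.erase i) := by
  rw [totalWeight, totalWeight, sum_placements_of_mem_right hi, sum_placements_of_mem_right hi,
    Finset.sum_filter, ← Finset.sum_add_distrib]
  refine Finset.sum_congr rfl fun q _ => ?_
  by_cases hq : q < i
  · have hz (G : Finset (ℕ × ℕ)) : weight X Y i (i + 1) (insert (q, i) G) = 0 :=
      weight_eq_zero (Finset.mem_insert_self _ _) hq (Nat.lt_succ_self i)
    rw [if_pos hq, Finset.sum_eq_zero fun G _ => hz G, zero_add, totalWeight, Finset.mul_sum]
    refine Finset.sum_congr rfl fun G hG => ?_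
    rw [weight_insert_value_of_lt hq (notMem_of_mem_placements_erase hG)]
    by_cases hw : ∀ e ∈ G, ¬(e.1 < i ∧ e.2 < i + 1)
    · rw [entryWeight_insert_value hq hG hw]
    -- If another entry lies in the box, both sides vanish whatever the factor is.
    · push Not at hw
      obtain ⟨e, he, h1, h2⟩ := hw
      rw [weight_eq_zero he h1 h2, mul_zero, mul_zero]
  · rw [if_neg hq, add_zero]
    exact Finset.sum_congr rfl fun G hG =>
      weight_insert_value_of_le (not_lt.1 hq) (notMem_of_mem_placements_erase hG)

theorem totalWeight_position_step (X Y : R) {i : ℕ} {P V : Finset ℕ} (hi : i ∈ P) :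
    totalWeight X Y i (i + 1) P V = totalWeight X Y (i + 1) (i + 1) P V
      + ∑ u ∈ V with u < i + 1,
          (if u < i then if ∀ v ∈ V, u ≤ v then X + 1 else 1
            else if (∀ p ∈ P, i ≤ p) ∧ ∀ v ∈ V, u ≤ v then X + Y else 1)
          * totalWeight X Y (i + 1) (i + 1) (P.erase i) (V.erase u) := by
  rw [totalWeight, totalWeight, sum_placements_of_mem_left hi, sum_placements_of_mem_left hi,
    Finset.sum_filter, ← Finset.sum_add_distrib]
  refine Finset.sum_congr rfl fun u _ => ?_
  by_cases hu : u < i + 1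
  · have hz (G : Finset (ℕ × ℕ)) : weight X Y (i + 1) (i + 1) (insert (i, u) G) = 0 :=
      weight_eq_zero (Finset.mem_insert_self _ _) (Nat.lt_succ_self i) hu
    rw [if_pos hu, Finset.sum_eq_zero fun G _ => hz G, zero_add, totalWeight, Finset.mul_sum]
    refine Finset.sum_congr rfl fun G hG => ?_
    rw [weight_insert_position_of_le (Nat.le_of_lt_succ hu) (notMem_of_mem_placements_erase hG)]
    by_cases hw : ∀ e ∈ G, ¬(e.1 < i + 1 ∧ e.2 < i + 1)
    · rw [entryWeight_insert_position (Nat.le_of_lt_succ hu) hG hw]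
    · push Not at hw
      obtain ⟨e, he, h1, h2⟩ := hw
      rw [weight_eq_zero he h1 h2, mul_zero, mul_zero]
  · rw [if_neg hu, add_zero]
    exact Finset.sum_congr rfl fun G hG =>
      weight_insert_position_of_lt (by lia) (notMem_of_mem_placements_erase hG)

theorem sum_ite_forall_le (S : Finset ℕ) (hS : S.Nonempty) (y : R) :
    ∑ q ∈ S, (if ∀ p ∈ S, q ≤ p then y else 1) = y + S.card - 1 := by
  have h1 := S.min'_mem hS
  rw [← Finset.add_sum_erase S _ h1, if_pos fun p hp => S.min'_le p hp,
    Finset.sum_congr rfl (g := fun _ => (1 : R)), Finset.sum_const, Finset.card_erase_of_mem h1,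
    nsmul_one, Nat.cast_sub (Finset.card_pos.2 hS), Nat.cast_one]
  · ring
  · intro q hq
    rw [Finset.mem_erase] at hq
    exact if_neg fun h => hq.1 (le_antisymm (h _ h1) (S.min'_le q hq.2))

/-- At the end of the scan every remaining pair lies in the forbidden box, so only the empty
bijection survives. -/
theorem totalWeight_self (X Y : R) (n h : ℕ) {P V : Finset ℕ} (hP : ∀ p ∈ P, p < n)
    (hV : ∀ v ∈ V, v < n) (hPh : P.card = h) (hVh : V.card = h) :
    totalWeight X Y n n P V = if h = 0 then 1 else 0 := by
  split_ifs with h0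
  · subst h0
    rw [Finset.card_eq_zero] at hPh hVh
    subst hPh hVh
    have : placements ∅ ∅ = {∅} := by
      ext G
      simp only [mem_placements, Finset.notMem_empty, false_imp_iff, implies_true, and_true,
        Finset.mem_singleton, and_self, imp_false]
      exact ⟨fun h => Finset.eq_empty_of_forall_notMem fun e => h e.1 e.2, fun h => by simp [h]⟩
    rw [totalWeight, this, Finset.sum_singleton, weight, Finset.prod_empty]
  · refine Finset.sum_eq_zero fun G hG => ?_
    obtain ⟨p, hp⟩ := Finset.card_pos.1 (by lia : 0 < P.card)
    obtain ⟨h1, h2, -⟩ := mem_placements.1 hG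
    obtain ⟨v, hv, -⟩ := h2 p hp
    exact weight_eq_zero hv (hP p hp) (hV v (h1 p v hv).2)

end Weights

/-! ### The permutation weights satisfy the moment recursion -/

section Recursion

variable {R : Type*} [CommRing R]

theorem sum_open_positions (y : R) {i h : ℕ} {P : Finset ℕ} (hPh : (P.filter (· < i)).card = h) :
    ∑ q ∈ P with q < i, (if ∀ p ∈ P, q ≤ p then y else 1) = if h = 0 then 0 else y + h - 1 := by
  split_ifs with h0
  · rw [Finset.card_eq_zero.1 (hPh.trans h0), Finset.sum_empty]
  · rw [← hPh, ← sum_ite_forall_le _ (Finset.card_pos.1 (by lia))]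
    refine Finset.sum_congr rfl fun q hq =>
      if_congr ⟨fun hp p hpf => ?_, fun hp p hpP => ?_⟩ rfl rfl
    · exact hp p (Finset.mem_filter.1 hpf).1
    · by_cases hpi : p < i
      · exact hp p (Finset.mem_filter.2 ⟨hpP, hpi⟩)
      · have := (Finset.mem_filter.1 hq).2
        lia

theorem sum_open_values (X Y : R) {i k : ℕ} {P V : Finset ℕ}
    (hPk : (P.filter (· < i)).card = k) (hVk : (V.filter (· < i + 1)).card = k + 1) :
    ∑ u ∈ V with u < i + 1, (if u < i then if ∀ v ∈ V, u ≤ v then X + 1 else 1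
      else if (∀ p ∈ P, i ≤ p) ∧ ∀ v ∈ V, u ≤ v then X + Y else 1)
      = if i ∈ V ∧ k = 0 then X + Y else X + 1 + k := by
  split_ifs with h
  · obtain ⟨hi, rfl⟩ := h
    obtain ⟨a, ha⟩ := Finset.card_eq_one.1 hVk
    have hia : i ∈ V.filter (· < i + 1) := by simp [hi]
    obtain rfl : i = a := Finset.mem_singleton.1 (ha ▸ hia)
    rw [ha, Finset.sum_singleton, if_neg (lt_irrefl i), if_pos]
    constructor
    · intro p hp
      by_contra! hpi
      exact Finset.notMem_empty p
        ((Finset.card_eq_zero.1 hPk) ▸ Finset.mem_filter.2 ⟨hp, hpi⟩)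
    · intro v hv
      by_contra! hvi
      have : v ∈ V.filter (· < i + 1) := Finset.mem_filter.2 ⟨hv, by lia⟩
      rw [ha, Finset.mem_singleton] at this
      lia
  -- Away from the pivot case the diagonal choice u = i follows the ordinary rule: it forces k > 0,
  -- so a smaller value is open and both factors are 1.
  · have hs := sum_open_positions (X + 1) hVk
    rw [if_neg (Nat.succ_ne_zero k)] at hs
    rw [Nat.cast_succ, add_sub_assoc, add_sub_cancel_right] at hs
    rw [← hs]
    refine Finset.sum_congr rfl fun u hu => ?_
    rw [Finset.mem_filter] at hu
    split_ifs with h1 h2 h3 h4 h5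
    any_goals rfl
    · obtain rfl : u = i := by lia
      refine absurd h3.1 ?_
      obtain ⟨p, hp⟩ := Finset.card_pos.1 (by lia : 0 < (P.filter (· < u)).card)
      rw [Finset.mem_filter] at hp
      exact fun h => absurd (h p hp.1) (by lia)
    · tauto
    · obtain rfl : u = i := by lia
      obtain ⟨v, hv, hvu⟩ := Finset.exists_mem_ne (by lia : 1 < (V.filter (· < u + 1)).card) u
      rw [Finset.mem_filter] at hv
      have := h5 v hv.1
      lia

theorem card_filter_lt_succ {S : Finset ℕ} {i : ℕ} (hi : i ∈ S) :
    (S.filter (· < i + 1)).card = (S.filter (· < i)).card + 1 := by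
  rw [show S.filter (· < i + 1) = insert i (S.filter (· < i)) by grind,
    Finset.card_insert_of_notMem (by simp)]

theorem card_filter_lt_succ_erase (S : Finset ℕ) (i : ℕ) :
    ((S.erase i).filter (· < i + 1)).card = (S.filter (· < i)).card := by
  congr 1
  grind

theorem card_filter_erase {S : Finset ℕ} {u j : ℕ} (hu : u ∈ S) (huj : u < j) :
    ((S.erase u).filter (· < j)).card = (S.filter (· < j)).card - 1 := by
  rw [Finset.filter_erase, Finset.card_erase_of_mem (Finset.mem_filter.2 ⟨hu, huj⟩)]

/-- From `j` on, `S` consists of the numbers less than `n`. -/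
def IsScanned (n j : ℕ) (S : Finset ℕ) : Prop := ∀ p, j ≤ p → (p ∈ S ↔ p < n)

theorem IsScanned.mono {n j k : ℕ} {S : Finset ℕ} (hS : IsScanned n j S) (hjk : j ≤ k) :
    IsScanned n k S := fun p hp => hS p (hjk.trans hp)

theorem IsScanned.erase {n j u : ℕ} {S : Finset ℕ} (hS : IsScanned n j S) (hu : u < j) :
    IsScanned n j (S.erase u) := fun p hp => by
  rw [Finset.mem_erase, hS p hp]
  lia

/-- Position i either stays open, leaving k + 1 open positions and values, or takes one of the k + 1
open values, leaving k. -/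
theorem totalWeight_position_rec (X Y : R) {n i k : ℕ} {m : ℕ → R} (hin : i < n)
    (hm : ∀ P V h, IsScanned n (i + 1) P → IsScanned n (i + 1) V →
      (P.filter (· < i + 1)).card = h → (V.filter (· < i + 1)).card = h →
      totalWeight X Y (i + 1) (i + 1) P V = m h)
    {P V : Finset ℕ} (hP : IsScanned n i P) (hV : IsScanned n (i + 1) V)
    (hPk : (P.filter (· < i)).card = k) (hVk : (V.filter (· < i + 1)).card = k + 1) :
    totalWeight X Y i (i + 1) P V
      = m (k + 1) + (if i ∈ V ∧ k = 0 then X + Y else X + 1 + k) * m k := by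
  have hiP : i ∈ P := (hP i le_rfl).2 hin
  rw [totalWeight_position_step X Y hiP, ← sum_open_values X Y hPk hVk, Finset.sum_mul,
    hm P V (k + 1) (hP.mono (Nat.le_succ i)) hV (by rw [card_filter_lt_succ hiP, hPk]) hVk]
  congr 1
  refine Finset.sum_congr rfl fun u hu => ?_
  rw [Finset.mem_filter] at hu
  rw [hm (P.erase i) (V.erase u) k ((hP.mono (Nat.le_succ i)).erase (Nat.lt_succ_self i))
    (hV.erase hu.2) (by rw [card_filter_lt_succ_erase, hPk])
    (by rw [card_filter_erase hu.1 hu.2, hVk, Nat.add_sub_cancel])]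

/-- The values `moment` for the associated Laguerre polynomials. -/
def laguerreMoment (X Y : R) : ℕ → ℕ → R :=
  moment (fun n => 2 * (n : R) + X + Y) (fun n => ((n : R) + X) * ((n : R) - 1 + Y))

/-- Induction on the number d of remaining stages. Only the number h of open positions matters,
since the weights depend on the relative order of the open ones. -/
theorem totalWeight_eq_moment (X Y : R) (n : ℕ) : ∀ (d i : ℕ) (P V : Finset ℕ) (h : ℕ),
    i + d = n → IsScanned n i P → IsScanned n i V →
    (P.filter (· < i)).card = h → (V.filter (· < i)).card = h →
    totalWeight X Y i i P V = laguerreMoment X Y d h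
  | 0, i, P, V, h, hi, hP, hV, hPh, hVh => by
    obtain rfl : i = n := hi
    have key {S : Finset ℕ} (hS : IsScanned i i S) : ∀ p ∈ S, p < i := fun p hp => by
      by_contra! hpi
      exact absurd ((hS p hpi).1 hp) (by lia)
    rw [Finset.filter_true_of_mem (key hP)] at hPh
    rw [Finset.filter_true_of_mem (key hV)] at hVh
    rw [totalWeight_self X Y i h (key hP) (key hV) hPh hVh]
    cases h <;> simp [laguerreMoment, moment]
  | d + 1, i, P, V, h, hi, hP, hV, hPh, hVh => by
    have hin : i < n := by lia
    have hiV : i ∈ V := (hV i le_rfl).2 hin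
    have hm := fun P V h => totalWeight_eq_moment X Y n d (i + 1) P V h (by lia)
    rw [totalWeight_value_step X Y hiV,
      totalWeight_position_rec X Y hin hm hP (hV.mono (Nat.le_succ i)) hPh
        (by rw [card_filter_lt_succ hiV, hVh])]
    cases h with
    | zero =>
      rw [Finset.card_eq_zero.1 hPh, Finset.sum_empty, if_pos ⟨hiV, rfl⟩, laguerreMoment, moment]
      simp
    | succ h =>
      have hT : ∀ q ∈ P.filter (· < i), (if ∀ p ∈ P, q ≤ p then Y else 1)
          * totalWeight X Y i (i + 1) (P.erase q) (V.erase i)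
          = (if ∀ p ∈ P, q ≤ p then Y else 1) * (laguerreMoment X Y d (h + 1)
            + (X + 1 + h) * laguerreMoment X Y d h) := by
        intro q hq
        rw [Finset.mem_filter] at hq
        -- Value i is used up, so position i cannot carry a pivot and X + 1 + h is right even for h
        -- = 0.
        rw [totalWeight_position_rec X Y hin hm (hP.erase hq.2)
          (fun p hp => by rw [Finset.mem_erase, hV p (by lia)]; lia)
          (by rw [card_filter_erase hq.1 hq.2, hPh, Nat.add_sub_cancel])
          (by rw [card_filter_lt_succ_erase, hVh]), if_neg (c := i ∈ V.erase i ∧ h = 0) (by simp)]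
      rw [Finset.sum_congr rfl hT, ← Finset.sum_mul, sum_open_positions Y hPh,
        if_neg (Nat.succ_ne_zero h), if_neg (by lia), laguerreMoment,
        moment]
      push_cast
      ring

theorem totalWeight_range (X Y : R) (n : ℕ) :
    totalWeight X Y 0 0 (Finset.range n) (Finset.range n)
      = laguerreMoment X Y n 0 :=
  totalWeight_eq_moment X Y n n 0 _ _ 0 (zero_add n) (fun p _ => Finset.mem_range)
    (fun p _ => Finset.mem_range) (by simp) (by simp)

end Recursion

/-! ### From graphs back to permutations and their statistics -/

section Permutations

variable {n : ℕ}

/-- The graph of a permutation. -/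
def permGraph (π : Equiv.Perm (Fin n)) : Finset (ℕ × ℕ) :=
  Finset.univ.image fun i : Fin n => ((i : ℕ), (π i : ℕ))

theorem mk_mem_permGraph {π : Equiv.Perm (Fin n)} {p v : ℕ} :
    (p, v) ∈ permGraph π ↔ ∃ i : Fin n, (i : ℕ) = p ∧ (π i : ℕ) = v := by
  simp [permGraph]

theorem permGraph_mem_placements (π : Equiv.Perm (Fin n)) :
    permGraph π ∈ placements (Finset.range n) (Finset.range n) := by
  simp only [mem_placements, mk_mem_permGraph, Finset.mem_range]
  refine ⟨?_, fun p hp => ?_, fun v hv => ?_⟩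
  · rintro _ _ ⟨i, rfl, rfl⟩
    exact ⟨i.2, (π i).2⟩
  · refine ⟨π ⟨p, hp⟩, ⟨⟨p, hp⟩, rfl, rfl⟩, ?_⟩
    rintro _ ⟨i, rfl, rfl⟩
    rfl
  · refine ⟨π.symm ⟨v, hv⟩, ⟨π.symm ⟨v, hv⟩, rfl, by simp⟩, ?_⟩
    rintro _ ⟨i, rfl, rfl⟩
    simp

theorem permGraph_injective : Function.Injective (permGraph (n := n)) := by
  intro π σ h
  ext i
  have h1 : ((i : ℕ), (π i : ℕ)) ∈ permGraph σ := h ▸ mk_mem_permGraph.2 ⟨i, rfl, rfl⟩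
  obtain ⟨j, hj, hji⟩ := mk_mem_permGraph.1 h1
  rw [← hji, Fin.ext hj]

theorem exists_permGraph_eq {G : Finset (ℕ × ℕ)}
    (hG : G ∈ placements (Finset.range n) (Finset.range n)) :
    ∃ π : Equiv.Perm (Fin n), permGraph π = G := by
  obtain ⟨h1, h2, h3⟩ := mem_placements.1 hG
  simp only [Finset.mem_range] at h1 h2 h3
  have hf : ∀ i : Fin n, ∃ j : Fin n, ((i : ℕ), (j : ℕ)) ∈ G := fun i => by
    obtain ⟨v, hv, -⟩ := h2 i i.2
    exact ⟨⟨v, (h1 _ _ hv).2⟩, hv⟩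
  choose f hf using hf
  have hinj : Function.Injective f := fun i j hij => by
    have hj := hf j
    rw [← hij] at hj
    exact Fin.ext ((h3 _ (f i).2).unique (hf i) hj)
  refine ⟨Equiv.ofBijective f (Finite.injective_iff_bijective.1 hinj), ?_⟩
  ext ⟨p, v⟩
  rw [mk_mem_permGraph]
  constructor
  · rintro ⟨i, rfl, rfl⟩
    exact hf i
  · intro h
    exact ⟨⟨p, (h1 _ _ h).1⟩, rfl, (h2 p (h1 _ _ h).1).unique (hf ⟨p, (h1 _ _ h).1⟩) h⟩

theorem sum_placements_range {M : Type*} [AddCommMonoid M] (F : Finset (ℕ × ℕ) → M) :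
    ∑ G ∈ placements (Finset.range n) (Finset.range n), F G
      = ∑ π : Equiv.Perm (Fin n), F (permGraph π) := by
  symm
  exact Finset.sum_bij (fun π _ => permGraph π) (fun π _ => permGraph_mem_placements π)
    (fun _ _ _ _ h => permGraph_injective h)
    (fun G hG => by simpa using exists_permGraph_eq hG) fun _ _ => rfl

theorem image_Iio_subset_of_LRmax {π : Equiv.Perm (Fin n)} {i : Fin n}
    (h : ∀ j, j < i → π j < π i) : (Finset.Iio i).image π ⊆ Finset.Iio (π i) := by
  intro v hv
  obtain ⟨j, hj, rfl⟩ := Finset.mem_image.1 hv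
  exact Finset.mem_Iio.2 (h j (Finset.mem_Iio.1 hj))

theorem image_Ioi_subset_of_RLmin {π : Equiv.Perm (Fin n)} {i : Fin n}
    (h : ∀ j, i < j → π i < π j) : (Finset.Ioi i).image π ⊆ Finset.Ioi (π i) := by
  intro v hv
  obtain ⟨j, hj, rfl⟩ := Finset.mem_image.1 hv
  exact Finset.mem_Ioi.2 (h j (Finset.mem_Ioi.1 hj))

/-- The i earlier entries inject into the values below π i. -/
theorem le_apply_of_LRmax {π : Equiv.Perm (Fin n)} {i : Fin n} (h : ∀ j, j < i → π j < π i) :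
    i ≤ π i := by
  have := Finset.card_le_card (image_Iio_subset_of_LRmax h)
  rwa [Finset.card_image_of_injective _ π.injective, Fin.card_Iio, Fin.card_Iio] at this

theorem apply_le_of_RLmin {π : Equiv.Perm (Fin n)} {i : Fin n} (h : ∀ j, i < j → π i < π j) :
    π i ≤ i := by
  have := Finset.card_le_card (image_Ioi_subset_of_RLmin h)
  rw [Finset.card_image_of_injective _ π.injective, Fin.card_Ioi, Fin.card_Ioi] at this
  rw [Fin.le_def]
  lia

/-- At a fixed point that injection is between sets of equal size, so all smaller values are already
used on the left. -/
theorem RLmin_of_LRmax_of_fixed {π : Equiv.Perm (Fin n)} {i : Fin n} (hi : π i = i)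
    (h : ∀ j, j < i → π j < π i) : ∀ j, i < j → π i < π j := by
  have he := Finset.eq_of_subset_of_card_le (image_Iio_subset_of_LRmax h)
    (by rw [Finset.card_image_of_injective _ π.injective, hi])
  intro j hj
  by_contra! hlt
  have hne : π j ≠ π i := fun e => hj.ne' (π.injective e)
  have hm : π j ∈ (Finset.Iio i).image π := he ▸ Finset.mem_Iio.2 (lt_of_le_of_ne hlt hne)
  rw [Finset.mem_image] at hm
  obtain ⟨k, hk, hkj⟩ := hm
  rw [π.injective hkj, Finset.mem_Iio] at hk
  exact lt_asymm hj hk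

theorem LRmax_of_RLmin_of_fixed {π : Equiv.Perm (Fin n)} {i : Fin n} (hi : π i = i)
    (h : ∀ j, i < j → π i < π j) : ∀ j, j < i → π j < π i := by
  have he := Finset.eq_of_subset_of_card_le (image_Ioi_subset_of_RLmin h)
    (by rw [Finset.card_image_of_injective _ π.injective, hi])
  intro j hj
  by_contra! hlt
  have hne : π i ≠ π j := fun e => hj.ne' (π.injective e)
  have hm : π j ∈ (Finset.Ioi i).image π := he ▸ Finset.mem_Ioi.2 (lt_of_le_of_ne hlt hne)
  rw [Finset.mem_image] at hm
  obtain ⟨k, hk, hkj⟩ := hm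
  rw [π.injective hkj, Finset.mem_Ioi] at hk
  exact lt_asymm hj hk

variable {R : Type*} [CommRing R]

/-- Strictly off the diagonal, the condition not tested by `entryWeight` fails automatically; on it,
both conditions are equivalent, so only X + Y and 1 occur. -/
theorem entryWeight_permGraph (X Y : R) (π : Equiv.Perm (Fin n)) (i : Fin n) :
    entryWeight X Y (permGraph π) (i, π i) =
      if ∀ j, j < i → π j < π i then if ∀ j, i < j → π i < π j then X + Y else Y
      else if ∀ j, i < j → π i < π j then X + 1 else 1 := by
  have h1 : (∀ f ∈ permGraph π, f.1 < (i : ℕ) → f.2 < (π i : ℕ)) ↔ ∀ j, j < i → π j < π i := by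
    simp [permGraph]
  have h2 : (∀ f ∈ permGraph π, (i : ℕ) < f.1 → (π i : ℕ) < f.2) ↔ ∀ j, i < j → π i < π j := by
    simp [permGraph]
  simp only [entryWeight, h1, h2, Fin.val_fin_lt]
  rcases lt_trichotomy i (π i) with h | h | h
  · have h3 : ¬∀ j, i < j → π i < π j := fun h' => (apply_le_of_RLmin h').not_gt h
    simp only [h, h3, if_true, if_false]
  · have h3 : (∀ j, j < i → π j < π i) ↔ ∀ j, i < j → π i < π j :=
      ⟨RLmin_of_LRmax_of_fixed h.symm, LRmax_of_RLmin_of_fixed h.symm⟩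
    rw [if_neg h.not_lt, if_neg h.not_gt]
    simp only [h3, and_self]
    split_ifs <;> rfl
  · have h3 : ¬∀ j, j < i → π j < π i := fun h' => (le_apply_of_LRmax h').not_gt h
    simp only [h, h.not_gt, h3, if_true, if_false]

theorem prod_ite_ite_mem {ι : Type*} [Fintype ι] [DecidableEq ι] (A B : Finset ι) (x y z : R) :
    ∏ i, (if i ∈ A then if i ∈ B then y else z else if i ∈ B then x else 1)
      = x ^ (B.card - (A ∩ B).card) * y ^ (A ∩ B).card * z ^ (A.card - (A ∩ B).card) := by
  have hB : B.card - (A ∩ B).card = (B \ A).card := by rw [Finset.card_sdiff]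
  have hA : A.card - (A ∩ B).card = (A \ B).card := by rw [Finset.card_sdiff, Finset.inter_comm]
  rw [hA, hB, ← Finset.prod_const, ← Finset.prod_const, ← Finset.prod_const,
    ← Finset.univ_inter (B \ A), ← Finset.univ_inter (A ∩ B), ← Finset.univ_inter (A \ B),
    ← Finset.prod_ite_mem, ← Finset.prod_ite_mem, ← Finset.prod_ite_mem,
    ← Finset.prod_mul_distrib, ← Finset.prod_mul_distrib]
  refine Finset.prod_congr rfl fun i _ => ?_
  by_cases h1 : i ∈ A <;> by_cases h2 : i ∈ B <;> simp [h1, h2]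

theorem weight_permGraph (X Y : R) (π : Equiv.Perm (Fin n)) :
    weight X Y 0 0 (permGraph π)
      = (X + 1) ^ (RLmin π - pivot π) * (X + Y) ^ pivot π * Y ^ (LRmax π - pivot π) := by
  rw [RLmin, LRmax, pivot, RLMIN, LRMAX, ← Finset.image_inter _ _ π.injective,
    Finset.card_image_of_injective _ π.injective, Finset.card_image_of_injective _ π.injective,
    Finset.card_image_of_injective _ π.injective, ← prod_ite_ite_mem, weight, permGraph,
    Finset.prod_image fun i _ j _ h => Fin.ext (Prod.mk.inj h).1]
  refine Finset.prod_congr rfl fun i _ => ?_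
  rw [if_neg (by simp)]
  simpa [permGraph] using entryWeight_permGraph X Y π i

/-- The moments of the associated Laguerre polynomials count permutations. -/
theorem laguerreMoment_eq_sum_perm (X Y : R) (n : ℕ) :
    laguerreMoment X Y n 0
      = ∑ π : Equiv.Perm (Fin n),
        (X + 1) ^ (RLmin π - pivot π) * (X + Y) ^ pivot π * Y ^ (LRmax π - pivot π) := by
  rw [← totalWeight_range, totalWeight, sum_placements_range]
  exact Finset.sum_congr rfl fun π _ => weight_permGraph X Y π

/-- Integration of polynomials as a linear functional. -/
noncomputable def integralFunctional (μ : Measure ℝ)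
    (hμ : ∀ q : Polynomial ℝ, Integrable (fun x => q.eval x) μ) : Polynomial ℝ →ₗ[ℝ] ℝ where
  toFun q := ∫ x, q.eval x ∂μ
  map_add' q r := by
    simp only [Polynomial.eval_add]
    exact integral_add (hμ q) (hμ r)
  map_smul' c q := by
    simp only [Polynomial.eval_smul, RingHom.id_apply, smul_eq_mul]
    exact integral_const_mul c _

theorem IsOrthogonalityMeasure.isMomentFunctional {p : ℕ → Polynomial ℝ} {μ : Measure ℝ}
    (hμ : IsOrthogonalityMeasure p μ) :
    IsMomentFunctional p (integralFunctional μ hμ.integrable) where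
  map_one := by
    simp [integralFunctional, Measure.real, hμ.mass_one]
  orthogonal m n hmn := by
    simpa [integralFunctional] using hμ.orthogonal m n hmn

end Permutations

end AssocLaguerre

theorem theorem3p4 :
    (∀ (R : Type*) [CommRing R] (X Y : R),
      (∃! L : Polynomial R →ₗ[R] R,
        AssocLaguerre.IsMomentFunctional (AssocLaguerre.assocLaguerre X Y) L) ∧
      ∀ L : Polynomial R →ₗ[R] R,
        AssocLaguerre.IsMomentFunctional (AssocLaguerre.assocLaguerre X Y) L →
        ∀ n : ℕ, L (Polynomial.X ^ n) =
          ∑ π : Equiv.Perm (Fin n),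
            (X + 1) ^ (AssocLaguerre.RLmin π - AssocLaguerre.pivot π)
              * (X + Y) ^ AssocLaguerre.pivot π
              * Y ^ (AssocLaguerre.LRmax π - AssocLaguerre.pivot π)) ∧
    (∀ (X Y : ℝ) (μ : MeasureTheory.Measure ℝ),
      AssocLaguerre.IsOrthogonalityMeasure (AssocLaguerre.assocLaguerre X Y) μ →
      ∀ n : ℕ, ∫ x, x ^ n ∂μ =
        ∑ π : Equiv.Perm (Fin n),
          (X + 1) ^ (AssocLaguerre.RLmin π - AssocLaguerre.pivot π)
            * (X + Y) ^ AssocLaguerre.pivot π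
            * Y ^ (AssocLaguerre.LRmax π - AssocLaguerre.pivot π)) := by
  refine ⟨fun R _ X Y => ⟨AssocLaguerre.existsUnique_isMomentFunctional _ _, fun L hL n => ?_⟩,
    fun X Y μ hμ n => ?_⟩
  · exact (hL.apply_X_pow n).trans (AssocLaguerre.laguerreMoment_eq_sum_perm X Y n)
  · have h := (hμ.isMomentFunctional.apply_X_pow n).trans
      (AssocLaguerre.laguerreMoment_eq_sum_perm X Y n)
    simpa [AssocLaguerre.integralFunctional] using h
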